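/- Permutations of length $n$ are written $\sigma=\sigma_1\sigma_2\ldots\sigma_n$, and occurrences of patterns are consecutive: a pattern $\pi$ of length $r$ occurs in $\sigma$ at position $i$ if the entries of $\sigma_i\sigma_{i+1}\ldots\sigma_{i+r-1}$ are in the same relative order as those of $\pi$. Let $P=\{132,231\}$. For $l\ge1$, an $l$-cluster of length $n$ is a tuple $(\sigma,\pi_1,\ldots,\pi_l,i_1,\ldots,i_l)$, where $\sigma$ is a permutation of length $n$, $\pi_k\in P$ occurs in $\sigma$ at position $i_k$ for $k=1,\ldots,l$, $i_k<i_{k+1}<i_k+r_k$ for $1\le k<l$ (where $r_k$ is the length of $\pi_k$), $i_1=1$, and $n=i_l+r_l-1$. By convention the permutation of length $1$, with nothing marked, is the only $0$-cluster. Let $c_{n,l}$ be the number of $l$-clusters of length $n$. Let the tangent numbers $E_{2l+1}$ be defined by $\tan x=\sum_{l\ge0}E_{2l+1}\frac{x^{2l+1}}{(2l+1)!}$, let $\pi_{n,k}$ be the number of permutations of length $n$ with exactly $k$ occurrences of patterns from $P$, and let $\Pi(x,t)=\sum_{n,k\ge0}\pi_{n,k}\frac{x^n}{n!}t^k$. Theorem.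 (1) For all $n,l\ge0$, a permutation $\sigma$ of length $n$ is the underlying permutation of an $l$-cluster if and only if $n=2l+1$ and $\sigma$ is an up--down permutation, that is, $\sigma_1<\sigma_2>\sigma_3<\cdots<\sigma_{2l}>\sigma_{2l+1}$; in that case $\sigma$ underlies exactly one $l$-cluster. (2) For all $n,l\ge0$, $c_{n,l}\ne0$ if and only if $n=2l+1$, and $c_{2l+1,l}=E_{2l+1}$. (3) The series $1-t$ has a square root in $\mathbb{Q}[[t]]$, and for either choice of $\sqrt{1-t}$, $$\Pi(x,t)=\left(1-\frac{\tanh(x\sqrt{1-t})}{\sqrt{1-t}}\right)^{-1}$$ as formal power series in $x$ with coefficients in $\mathbb{Q}[[t]]$. -/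

import Mathlib

namespace ConsecutivePattern

/-- A pattern: a permutation of some length `r`, in one-line notation `π 0, …, π (r - 1)`
(positions and values are numbered from `0`). -/
abbrev Pattern : Type := Σ r : ℕ, Equiv.Perm (Fin r)

/-- The pattern `π` occurs in `σ` at the consecutive positions `i, …, i + r - 1`: the window lies
inside `σ` and its entries are in the same relative order as the entries of `π`, that is, the
standardization of the window is `π`. -/
def OccursAt {n : ℕ} (σ : Equiv.Perm (Fin n)) (i : ℕ) (π : Pattern) : Prop :=
  ∃ h : i + π.1 ≤ n, ∀ a b : Fin π.1,
    σ ⟨i + a, by omega⟩ < σ ⟨i + b, by omega⟩ ↔ π.2 a < π.2 b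

/-- The number of occurrences in `σ` of patterns from `P`. -/
noncomputable def occurrences (P : Set Pattern) {n : ℕ} (σ : Equiv.Perm (Fin n)) : ℕ :=
  Set.ncard {o : ℕ × Pattern | o.2 ∈ P ∧ OccursAt σ o.1 o.2}

/-- The number of permutations of length `n` with exactly `k` occurrences of patterns
from `P`. -/
noncomputable def occurrenceNumber (P : Set Pattern) (n k : ℕ) : ℕ :=
  Nat.card {σ : Equiv.Perm (Fin n) // occurrences P σ = k}

/-- The generating function `∑ (number of permutations of length n with k occurrences) xⁿ tᵏ / n!`.
The outer variable is `x`, the inner one is `t`. -/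
noncomputable def occurrenceSeries (P : Set Pattern) : PowerSeries (PowerSeries ℚ) :=
  PowerSeries.mk fun n => PowerSeries.mk fun k =>
    (occurrenceNumber P n k : ℚ) / (n.factorial : ℚ)

/-- `(σ, π, i)` is a `q`-cluster: the pattern `π k` from `P` occurs in `σ` at position `i k`,
the positions increase, neighbouring occurrences overlap, the first one starts at the first
position and the last one ends at the last position. By the usual convention the permutation of
length `1` (with nothing marked) is the only `0`-cluster. -/
structure IsCluster (P : Set Pattern) {n q : ℕ} (σ : Equiv.Perm (Fin n))
    (π : Fin q → Pattern) (i : Fin q → ℕ) : Prop where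
  mem : ∀ k, π k ∈ P
  occurs : ∀ k, OccursAt σ (i k) (π k)
  increasing : ∀ k k' : Fin q, (k : ℕ) + 1 = k' → i k < i k'
  linked : ∀ k k' : Fin q, (k : ℕ) + 1 = k' → i k' < i k + (π k).1
  first : ∀ k : Fin q, (k : ℕ) = 0 → i k = 0
  last : ∀ k : Fin q, (k : ℕ) + 1 = q → n = i k + (π k).1
  trivial : q = 0 → n = 1

/-- The number of `q`-clusters `(σ, π, i)` in which `σ` has length `n`. -/
noncomputable def clusterNumber (P : Set Pattern) (n q : ℕ) : ℕ :=
  Nat.card {c : Equiv.Perm (Fin n) × (Fin q → Pattern) × (Fin q → ℕ) //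
    IsCluster P c.1 c.2.1 c.2.2}

/-- Up–down permutations `a₁ < a₂ > a₃ < a₄ > ⋯` (position `j` holds `a_{j+1}`). -/
def IsUpDown {n : ℕ} (σ : Equiv.Perm (Fin n)) : Prop :=
  ∀ (j : ℕ) (h : j + 1 < n),
    (Even j → σ ⟨j, by omega⟩ < σ ⟨j + 1, h⟩) ∧
    (Odd j → σ ⟨j + 1, h⟩ < σ ⟨j, by omega⟩)

/-- The pattern `132`. -/
def pattern132 : Pattern := ⟨3, ⟨![0, 2, 1], ![0, 2, 1], by decide, by decide⟩⟩

/-- The pattern `231`. -/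
def pattern231 : Pattern := ⟨3, ⟨![1, 2, 0], ![2, 0, 1], by decide, by decide⟩⟩

/-- The pattern set `{132, 231}`. -/
def patterns132and231 : Set Pattern := {pattern132, pattern231}

/-- The power series `tan x = sin x / cos x`. -/
noncomputable def tanSeries : PowerSeries ℚ :=
  PowerSeries.sin ℚ * (PowerSeries.cos ℚ)⁻¹

/-- The tangent number `E_{2l+1}`: `tan x = ∑ E_{2l+1} x^{2l+1} / (2l+1)!`. -/
noncomputable def tangentNumber (l : ℕ) : ℚ :=
  ((2 * l + 1).factorial : ℚ) * PowerSeries.coeff (2 * l + 1) tanSeries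

/-- The power series `tanh x = (eˣ - e⁻ˣ) / (eˣ + e⁻ˣ)`. -/
noncomputable def tanhSeries : PowerSeries ℚ :=
  (PowerSeries.exp ℚ - PowerSeries.evalNegHom (PowerSeries.exp ℚ)) *
    (PowerSeries.exp ℚ + PowerSeries.evalNegHom (PowerSeries.exp ℚ))⁻¹

/-- For a power series `s` in `t` the power series `tanh (x s)` in `x` and `t`. -/
noncomputable def tanhMul (s : PowerSeries ℚ) : PowerSeries (PowerSeries ℚ) :=
  PowerSeries.rescale s (PowerSeries.map (algebraMap ℚ (PowerSeries ℚ)) tanhSeries)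

end ConsecutivePattern

namespace ConsecutivePattern

/-! A window matches 132 or 231 exactly when its middle entry is the largest, and the order of the
outer two entries decides which pattern it is. Occurrences are therefore interior peaks. Two peaks
are never adjacent (`not_peakFrom_succ`), so overlapping occurrences in a cluster are shifted by
exactly 2. This forces the positions 0, 2, 4, …, the length 2l+1 and the up–down shape, and makes
the marking unique. Up–down permutations of length 2l+1 are also those with l peaks, the largest
possible number (`isUpDown_iff_card_peakSet`).

For the enumeration, split a permutation at its maximum: peaks add up over the two sides, with one
more if both sides are nonempty (`peaks_append_cons`). For F = Π(x,t) this gives the Riccati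
equation F' = t(F-1)² + 2(F-1) + 1 with F(0) = 1, which 1/(1 - tanh(xs)/s) with s² = 1-t also
solves; uniqueness gives the closed form. Keeping only the top power of t in the same recurrence
leaves H' = 1 + H², H(0) = 0, hence H = tan and the cluster numbers are the tangent numbers. -/

/-! ### Formal differential equations for tan, tanh and the Riccati equation -/

open PowerSeries in
/-- A power series with zero constant term that solves a homogeneous linear differential equation
of first order vanishes. -/
theorem eq_zero_of_derivative_eq_mul {R : Type*} [CommRing R] [NoZeroDivisors R] [CharZero R]
    {f g : PowerSeries R} (h : derivative R f = g * f) (h0 : constantCoeff f = 0) : f = 0 := by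
  ext n
  rw [map_zero]
  induction n using Nat.strong_induction_on with
  | _ n ih =>
    cases n with
    | zero => simpa using h0
    | succ n =>
      have h1 : coeff n (derivative R f) = 0 := by
        rw [h, coeff_mul]
        refine Finset.sum_eq_zero fun p hp => ?_
        have := Finset.HasAntidiagonal.mem_antidiagonal.1 hp
        rw [ih p.2 (by omega), mul_zero]
      rw [coeff_derivative] at h1
      exact (mul_eq_zero.1 h1).resolve_right (by exact_mod_cast Nat.succ_ne_zero n)

open PowerSeries in
theorem derivative_rescale {R : Type*} [CommRing R] (s : R) (f : PowerSeries R) :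
    derivative R (rescale s f) = C s * rescale s (derivative R f) := by
  ext n
  simp only [coeff_derivative, coeff_rescale, coeff_C_mul]
  ring

open PowerSeries in
theorem derivative_map {R S : Type*} [CommRing R] [CommRing S] (φ : R →+* S)
    (f : PowerSeries R) : derivative S (map φ f) = map φ (derivative R f) := by
  ext n
  simp [coeff_derivative]

open PowerSeries in
theorem derivative_sin : derivative ℚ (PowerSeries.sin ℚ) = PowerSeries.cos ℚ := by
  ext n
  rw [coeff_derivative, sin, cos, coeff_mk, coeff_mk]
  by_cases h : Even n
  · have h2 : (n + 1) / 2 = n / 2 := by obtain ⟨m, rfl⟩ := h; omega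
    have : ((n : ℚ) + 1) ≠ 0 := by positivity
    simp [h, h2, Nat.even_add_one, Nat.factorial_succ]
    field_simp
  · simp [h, Nat.even_add_one]

open PowerSeries in
theorem derivative_cos : derivative ℚ (PowerSeries.cos ℚ) = -PowerSeries.sin ℚ := by
  ext n
  rw [coeff_derivative, map_neg, sin, cos, coeff_mk, coeff_mk]
  by_cases h : Even n
  · simp [h, Nat.even_add_one]
  · have h2 : (n + 1) / 2 = n / 2 + 1 := by
      obtain ⟨m, rfl⟩ := Nat.not_even_iff_odd.1 h; omega
    have : ((n : ℚ) + 1) ≠ 0 := by positivity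
    simp [h, h2, Nat.even_add_one, Nat.factorial_succ, pow_succ]
    field_simp

open PowerSeries in
theorem derivative_tanSeries : derivative ℚ tanSeries = 1 + tanSeries ^ 2 := by
  have hc : constantCoeff (PowerSeries.cos ℚ) ≠ 0 := by
    rw [← coeff_zero_eq_constantCoeff_apply]; simp [cos]
  have hT : tanSeries * PowerSeries.cos ℚ = PowerSeries.sin ℚ := by
    rw [tanSeries, mul_assoc, PowerSeries.inv_mul_cancel _ hc, mul_one]
  have hne : PowerSeries.cos ℚ ≠ 0 := fun h => hc (by rw [h, map_zero])
  have h := congrArg (derivative ℚ) hT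
  rw [Derivation.leibniz, derivative_sin, derivative_cos, smul_eq_mul, smul_eq_mul] at h
  apply mul_right_cancel₀ hne
  linear_combination h - tanSeries * hT

open PowerSeries in
theorem constantCoeff_tanSeries : constantCoeff tanSeries = 0 := by
  rw [tanSeries, map_mul, ← coeff_zero_eq_constantCoeff_apply (PowerSeries.sin ℚ)]
  simp [sin]

open PowerSeries in
theorem derivative_tanhSeries : derivative ℚ tanhSeries = 1 - tanhSeries ^ 2 := by
  set E := PowerSeries.exp ℚ with hE
  set F := evalNegHom E with hF
  have hc : constantCoeff (E + F) ≠ 0 := by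
    rw [← coeff_zero_eq_constantCoeff_apply]
    simp [hF, hE, evalNegHom, -coeff_zero_eq_constantCoeff]
  have hT : tanhSeries * (E + F) = E - F := by
    rw [tanhSeries, mul_assoc, PowerSeries.inv_mul_cancel _ hc, mul_one]
  have hne : E + F ≠ 0 := fun h => hc (by rw [h, map_zero])
  have hdE : derivative ℚ E = E := derivative_exp ℚ
  have hdF : derivative ℚ F = -F := by
    rw [hF, evalNegHom, derivative_rescale, hdE]
    simp
  have h := congrArg (derivative ℚ) hT
  rw [Derivation.leibniz, map_add, map_sub, hdE, hdF, smul_eq_mul, smul_eq_mul] at h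
  apply mul_right_cancel₀ hne
  linear_combination h + tanhSeries * hT

open PowerSeries in
theorem constantCoeff_tanhSeries : constantCoeff tanhSeries = 0 := by
  have : constantCoeff (evalNegHom (PowerSeries.exp ℚ)) = 1 := by
    rw [← coeff_zero_eq_constantCoeff_apply]; simp [evalNegHom]
  rw [tanhSeries, map_mul, map_sub, this]
  simp

open PowerSeries in
theorem derivative_tanhMul (s : PowerSeries ℚ) :
    derivative (PowerSeries ℚ) (tanhMul s) = C s * (1 - tanhMul s ^ 2) := by
  rw [tanhMul, derivative_rescale, derivative_map, derivative_tanhSeries]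
  simp

open PowerSeries in
theorem constantCoeff_tanhMul (s : PowerSeries ℚ) : constantCoeff (tanhMul s) = 0 := by
  have := constantCoeff_tanhSeries
  rw [← coeff_zero_eq_constantCoeff_apply] at this ⊢
  simp [tanhMul, -coeff_zero_eq_constantCoeff, this]

-- The root is the binomial series of exponent 1/2 at -t; exponents add under multiplication.
open PowerSeries in
theorem exists_sq_eq_one_sub_X : ∃ s : PowerSeries ℚ, s ^ 2 = 1 - PowerSeries.X := by
  refine ⟨rescale (-1 : ℚ) (PowerSeries.binomialSeries ℚ (1 / 2 : ℚ)), ?_⟩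
  have h : PowerSeries.binomialSeries ℚ (1 / 2 : ℚ) ^ 2 = 1 + X := by
    have := binomialSeries_nat (R := ℚ) (A := ℚ) 1
    rw [sq, ← binomialSeries_add]
    norm_num at this ⊢
    exact this
  rw [← map_pow, h, map_add, map_one, rescale_neg_one_X, sub_eq_add_neg]

open PowerSeries in
theorem mul_inv_cancel_of_sq_eq_one_sub_X {s : PowerSeries ℚ} (h : s ^ 2 = 1 - PowerSeries.X) :
    s * s⁻¹ = 1 := by
  apply PowerSeries.mul_inv_cancel
  intro h0
  have := congrArg constantCoeff h
  simp [h0] at this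

open PowerSeries in
/-- The Riccati equation of the peak generating function determines it. -/
theorem mul_one_sub_eq_one_of_derivative {R : Type*} [CommRing R] [NoZeroDivisors R] [CharZero R]
    {F T : PowerSeries R} {s r t : R} (hs : s ^ 2 = 1 - t) (hr : s * r = 1)
    (hT : derivative R T = C s * (1 - T ^ 2)) (hT0 : constantCoeff T = 0)
    (hF : derivative R F = C t * ((F - 1) * (F - 1)) + (F - 1) + (F - 1) + 1)
    (hF0 : constantCoeff F = 1) :
    F * (1 - C r * T) = 1 := by
  set U := C r * T with hU
  have hinv : C s * C r = (1 : PowerSeries R) := by rw [← map_mul, hr, map_one]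
  have hsU : C s * U = T := by rw [hU, ← mul_assoc, hinv, one_mul]
  have hs2 : C s ^ 2 = (1 - C t : PowerSeries R) := by
    rw [← map_pow, hs, map_sub, map_one]
  have hdU : derivative R U = 1 - (1 - C t) * U ^ 2 := by
    rw [hU, Derivation.leibniz, derivative_C, hT, ← hU, smul_zero, add_zero,
      smul_eq_mul, ← mul_assoc, mul_comm (C r), hinv, one_mul, ← hsU, mul_pow, hs2]
  rw [← sub_eq_zero]
  -- With V = 1 - U and q = 1 - t, the equations read F' = F² - q(F-1)² and V' = -1 + q(1-V)². In
  -- (FV - 1)' the part free of q is F(FV - 1) and the coefficient of q is (V - F)(FV - 1), whence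
  -- the multiplier.
  refine eq_zero_of_derivative_eq_mul (g := F + (1 - C t) * (1 - U - F)) ?_ ?_
  · rw [map_sub, Derivation.leibniz, map_sub, hdU, hF, derivative_one, smul_eq_mul, smul_eq_mul]
    ring
  · simp [hU, hF0, hT0]

-- Subtracting the two Riccati equations gives (H - tan)' = (H + tan)(H - tan).
open PowerSeries in
theorem eq_tanSeries {H : PowerSeries ℚ} (h0 : constantCoeff H = 0)
    (hH : derivative ℚ H = 1 + H ^ 2) : H = tanSeries := by
  rw [← sub_eq_zero]
  refine eq_zero_of_derivative_eq_mul (g := H + tanSeries) ?_ ?_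
  · rw [map_sub, hH, derivative_tanSeries]; ring
  · rw [map_sub, h0, constantCoeff_tanSeries, sub_zero]

/-! ### Peaks of words and splitting at the maximum -/

/-- The number of interior peaks of a list. -/
def peaks : List ℕ → ℕ
  | a :: b :: c :: l => (if a < b ∧ c < b then 1 else 0) + peaks (b :: c :: l)
  | _ => 0

theorem peaks_cons_of_forall_lt {m : ℕ} {l : List ℕ} (h : ∀ x ∈ l, x < m) :
    peaks (m :: l) = peaks l := by
  match l, h with
  | [], _ => rfl
  | [_], _ => rfl
  | b :: c :: l, h =>
    have := h b (by simp)
    rw [peaks, if_neg (by omega), zero_add]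

/-- A neighbour of `m` is never a peak, neither in the whole word nor as an end of its side, and `m`
is a peak once it has neighbours on both sides. All other windows lie within one side. -/
theorem peaks_append_cons {m : ℕ} {l₁ l₂ : List ℕ} (h₁ : ∀ x ∈ l₁, x < m) (h₂ : ∀ x ∈ l₂, x < m) :
    peaks (l₁ ++ m :: l₂) =
      peaks l₁ + peaks l₂ + if l₁.length = 0 ∨ l₂.length = 0 then 0 else 1 := by
  induction l₁ with
  | nil => simp [peaks_cons_of_forall_lt h₂, peaks]
  | cons a l₁ ih =>
    have ha : a < m := h₁ a (by simp)
    specialize ih fun x hx => h₁ x (by simp [hx])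
    -- The window starting at `a` has `m` in its middle, at its end, or not at all.
    match l₁, ih with
    | [], _ =>
      match l₂, h₂ with
      | [], _ => rfl
      | b :: l₂, h₂ =>
        have hb : b < m := h₂ b (by simp)
        have := peaks_cons_of_forall_lt h₂
        simp only [List.cons_append, List.nil_append]
        rw [peaks, this, if_pos ⟨ha, hb⟩]
        simp [peaks]
        ring
    | [b], ih =>
      have hb : b < m := h₁ b (by simp)
      simp only [List.cons_append, List.nil_append] at ih ⊢
      rw [peaks, ih, if_neg (by omega), zero_add]
      simp [peaks]
    | b :: c :: l, ih =>
      simp only [List.cons_append] at ih ⊢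
      rw [peaks, ih, peaks]
      simp
      ring

/-! ### Peak polynomials and their recurrence -/

/-- The linear arrangements of a finite set of numbers. -/
def orders (S : Finset ℕ) : Finset (List ℕ) := ⟨S.val.lists, Multiset.lists_nodup_finset S⟩

theorem mem_orders {S : Finset ℕ} {l : List ℕ} : l ∈ orders S ↔ l.Nodup ∧ l.toFinset = S := by
  have h : l ∈ orders S ↔ S.val = (l : Multiset ℕ) := Multiset.mem_lists_iff _ _
  rw [h]
  constructor
  · intro h
    refine ⟨Multiset.coe_nodup.1 (h ▸ S.nodup), ?_⟩
    ext x
    rw [List.mem_toFinset, ← Finset.mem_val, h, Multiset.mem_coe]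
  · rintro ⟨hl, rfl⟩
    rw [List.toFinset_val, hl.dedup]

theorem length_of_mem_orders {S : Finset ℕ} {l : List ℕ} (h : l ∈ orders S) :
    l.length = S.card := by
  obtain ⟨hl, rfl⟩ := mem_orders.1 h
  exact (List.toFinset_card_of_nodup hl).symm

theorem mem_of_mem_orders {S : Finset ℕ} {l : List ℕ} (h : l ∈ orders S) {x : ℕ} :
    x ∈ l ↔ x ∈ S := by
  obtain ⟨h, rfl⟩ := mem_orders.1 h
  exact List.mem_toFinset.symm

open Polynomial in
/-- The peak polynomial of the linear arrangements of a finite set. -/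
noncomputable def peakSum (S : Finset ℕ) : ℚ[X] := ∑ l ∈ orders S, X ^ peaks l

open Polynomial in
/-- The contribution of the maximum to the number of peaks, when it has `i` entries to its left and
`j` entries to its right. -/
noncomputable def peakWeight (i j : ℕ) : ℚ[X] := if i = 0 ∨ j = 0 then 1 else X

-- Cutting an arrangement at `m` is a bijection onto triples: the set `T` of entries to the left of
-- `m`, an arrangement of `T`, and one of `S \ T`.
open Polynomial in
theorem peakSum_insert {S : Finset ℕ} {m : ℕ} (hm : ∀ x ∈ S, x < m) :
    peakSum (insert m S) = ∑ T ∈ S.powerset,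
      peakWeight T.card (S \ T).card * (peakSum T * peakSum (S \ T)) := by
  have hmS : m ∉ S := fun h => lt_irrefl _ (hm m h)
  simp_rw [peakSum, Finset.sum_mul_sum, ← Finset.sum_product', Finset.mul_sum]
  rw [Finset.sum_sigma']
  symm
  refine Finset.sum_bij (fun x _ => x.2.1 ++ m :: x.2.2) ?_ ?_ ?_ ?_
  · rintro ⟨T, l₁, l₂⟩ hx
    simp only [Finset.mem_sigma, Finset.mem_powerset, Finset.mem_product] at hx
    obtain ⟨hT, h₁, h₂⟩ := hx
    obtain ⟨n₁, e₁⟩ := mem_orders.1 h₁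
    obtain ⟨n₂, e₂⟩ := mem_orders.1 h₂
    rw [mem_orders]
    constructor
    · rw [List.nodup_append', List.nodup_cons]
      refine ⟨n₁, ⟨?_, n₂⟩, ?_⟩
      · rw [mem_of_mem_orders h₂]; simp [hmS]
      · intro x hx hx'
        rw [mem_of_mem_orders h₁] at hx
        rw [List.mem_cons, mem_of_mem_orders h₂] at hx'
        rcases hx' with rfl | hx'
        · exact hmS (hT hx)
        · exact (Finset.mem_sdiff.1 hx').2 hx
    · rw [List.toFinset_append, List.toFinset_cons, e₁, e₂, Finset.union_insert,
        Finset.union_sdiff_of_subset hT]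
  · rintro ⟨T, l₁, l₂⟩ hx ⟨T', l₁', l₂'⟩ hx' h
    simp only [Finset.mem_sigma, Finset.mem_powerset, Finset.mem_product] at hx hx'
    obtain ⟨hT, h₁, h₂⟩ := hx
    obtain ⟨hT', h₁', h₂'⟩ := hx'
    have h1 : m ∉ l₁ := by
      rw [mem_of_mem_orders h₁]; exact fun h => hmS (hT h)
    have h2 : m ∉ l₂ := by
      rw [mem_of_mem_orders h₂]; exact fun h => hmS (Finset.sdiff_subset h)
    obtain ⟨rfl, -, rfl⟩ := (List.append_cons_inj_of_notMem h1 h2).1 h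
    obtain rfl : T = T' := (mem_orders.1 h₁).2.symm.trans (mem_orders.1 h₁').2
    rfl
  · intro l hl
    obtain ⟨l₁, l₂, rfl⟩ := List.append_of_mem
      ((mem_of_mem_orders hl).2 (Finset.mem_insert_self m S))
    obtain ⟨hn, he⟩ := mem_orders.1 hl
    rw [List.nodup_append', List.nodup_cons, List.disjoint_cons_right] at hn
    obtain ⟨n₁, ⟨hm₂, n₂⟩, hm₁, hd⟩ := hn
    have hsub : l₁.toFinset ⊆ S := by
      intro x hx
      rw [List.mem_toFinset] at hx
      have := (mem_of_mem_orders hl (x := x)).1 (by simp [hx])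
      refine (Finset.mem_insert.1 this).resolve_left ?_
      rintro rfl
      exact hm₁ hx
    refine ⟨⟨l₁.toFinset, l₁, l₂⟩, ?_, rfl⟩
    simp only [Finset.mem_sigma, Finset.mem_powerset, Finset.mem_product]
    refine ⟨hsub, mem_orders.2 ⟨n₁, rfl⟩, mem_orders.2 ⟨n₂, ?_⟩⟩
    ext x
    have := mem_of_mem_orders hl (x := x)
    simp only [List.mem_append, List.mem_cons, Finset.mem_insert] at this
    rw [List.mem_toFinset, Finset.mem_sdiff, List.mem_toFinset]
    constructor
    · intro hx
      refine ⟨(this.1 (Or.inr (Or.inr hx))).resolve_left ?_, fun h => hd h hx⟩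
      rintro rfl
      exact hm₂ hx
    · rintro ⟨hxS, hx⟩
      rcases this.2 (Or.inr hxS) with h | rfl | h
      · exact absurd h hx
      · exact absurd hxS hmS
      · exact h
  · rintro ⟨T, l₁, l₂⟩ hx
    simp only [Finset.mem_sigma, Finset.mem_powerset, Finset.mem_product] at hx
    obtain ⟨hT, h₁, h₂⟩ := hx
    rw [peaks_append_cons (fun x hx => hm x (hT ((mem_of_mem_orders h₁).1 hx)))
      (fun x hx => hm x (Finset.sdiff_subset ((mem_of_mem_orders h₂).1 hx))),
      length_of_mem_orders h₁, length_of_mem_orders h₂, pow_add, pow_add, peakWeight, mul_comm]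
    split_ifs <;> simp

/-- The peak polynomial of the permutations of length `n`. -/
noncomputable def peakPoly (n : ℕ) : Polynomial ℚ := peakSum (Finset.range n)

/-- Subsets are grouped by size. Since only subsets of `S` enter the hypothesis, the lemma can be
used inside the strong induction of `peakSum_eq_peakPoly`. -/
theorem sum_powerset_eq_sum_choose {S : Finset ℕ} {f : Finset ℕ → Polynomial ℚ}
    {g : ℕ → Polynomial ℚ} (hS : ∀ T ⊆ S, f T = g T.card) :
    ∑ T ∈ S.powerset,
      peakWeight T.card (S \ T).card * (f T * f (S \ T)) =
    ∑ k ∈ Finset.range (S.card + 1), S.card.choose k •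
      (peakWeight k (S.card - k) * (g k * g (S.card - k))) := by
  rw [← Finset.sum_powerset_apply_card
    (fun k => peakWeight k (S.card - k) * (g k * g (S.card - k)))]
  refine Finset.sum_congr rfl fun T hT => ?_
  rw [Finset.mem_powerset] at hT
  rw [hS T hT, hS _ Finset.sdiff_subset, Finset.card_sdiff_of_subset hT]

/-- Peaks depend only on relative order. Instead of relabelling, the maximum is removed both from
`S` and from the initial segment of the same size; the two recurrences agree by induction. -/
theorem peakSum_eq_peakPoly (S : Finset ℕ) : peakSum S = peakPoly S.card := by
  induction h : S.card using Nat.strong_induction_on generalizing S with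
  | _ n ih =>
    rcases S.eq_empty_or_nonempty with rfl | hne
    · simp only [Finset.card_empty] at h
      subst h
      rfl
    · set m := S.max' hne with hm
      have hmS : m ∈ S := S.max'_mem hne
      have hlt : ∀ x ∈ S.erase m, x < m := fun x hx =>
        lt_of_le_of_ne (S.le_max' x (Finset.mem_of_mem_erase hx)) (Finset.ne_of_mem_erase hx)
      have hc : (S.erase m).card + 1 = n := by rw [Finset.card_erase_add_one hmS, h]
      have key : ∀ S' : Finset ℕ, S'.card + 1 = n → ∀ T ⊆ S', peakSum T = peakPoly T.card :=
        fun S' hS' T hT => ih _ (by have := Finset.card_le_card hT; omega) T rfl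
      rw [← Finset.insert_erase hmS, peakSum_insert hlt,
        sum_powerset_eq_sum_choose (key _ hc), peakPoly, ← hc, Finset.range_add_one,
        peakSum_insert (by simp), sum_powerset_eq_sum_choose (key _ (by simpa using hc)),
        Finset.card_range, ← Finset.range_add_one]

theorem peakPoly_zero : peakPoly 0 = 1 := by
  have : orders ∅ = {[]} := by
    ext l
    rw [mem_orders, Finset.mem_singleton, List.toFinset_eq_empty_iff]
    constructor
    · exact fun h => h.2
    · rintro rfl; simp
  simp [peakPoly, peakSum, this, peaks]

theorem peakPoly_succ (n : ℕ) : peakPoly (n + 1) =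
    ∑ k ∈ Finset.range (n + 1), n.choose k •
      (peakWeight k (n - k) * (peakPoly k * peakPoly (n - k))) := by
  rw [peakPoly, Finset.range_add_one, peakSum_insert (by simp),
    sum_powerset_eq_sum_choose (fun T _ => peakSum_eq_peakPoly T), Finset.card_range,
    ← Finset.range_add_one]

/-- The recurrence for peak polynomials, divided by a factorial. -/
theorem peakPoly_succ_div_factorial (n : ℕ) :
    Polynomial.C ((n.factorial : ℚ)⁻¹) * peakPoly (n + 1) =
    ∑ p ∈ Finset.HasAntidiagonal.antidiagonal n, peakWeight p.1 p.2 *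
      ((Polynomial.C ((p.1.factorial : ℚ)⁻¹) * peakPoly p.1) *
        (Polynomial.C ((p.2.factorial : ℚ)⁻¹) * peakPoly p.2)) := by
  rw [peakPoly_succ, Finset.mul_sum, Finset.Nat.sum_antidiagonal_eq_sum_range_succ
    (fun i j => peakWeight i j *
      ((Polynomial.C ((i.factorial : ℚ)⁻¹) * peakPoly i) *
        (Polynomial.C ((j.factorial : ℚ)⁻¹) * peakPoly j)))]
  refine Finset.sum_congr rfl fun k hk => ?_
  have hk' : k ≤ n := by rw [Finset.mem_range] at hk; omega
  have h : Polynomial.C ((n.factorial : ℚ)⁻¹) * (n.choose k : Polynomial ℚ) =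
      Polynomial.C ((k.factorial : ℚ)⁻¹) * Polynomial.C (((n - k).factorial : ℚ)⁻¹) := by
    rw [← Polynomial.C_eq_natCast, ← Polynomial.C_mul, ← Polynomial.C_mul,
      Nat.cast_choose ℚ hk']
    congr 1
    have := Nat.factorial_ne_zero n
    field_simp
  rw [nsmul_eq_mul, ← mul_assoc, h]
  ring

/-! ### Occurrences as peaks, and the maximal number of peaks -/

/-- The middle one of the three entries of `σ` from position `i` on is the largest. -/
def PeakFrom {n : ℕ} (σ : Equiv.Perm (Fin n)) (i : ℕ) : Prop :=
  ∃ h : i + 3 ≤ n, σ ⟨i, by omega⟩ < σ ⟨i + 1, by omega⟩ ∧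
    σ ⟨i + 2, by omega⟩ < σ ⟨i + 1, by omega⟩

theorem occursAt_pattern132 {n : ℕ} (σ : Equiv.Perm (Fin n)) (i : ℕ) :
    OccursAt σ i pattern132 ↔ ∃ h : i + 3 ≤ n,
      σ ⟨i, by omega⟩ < σ ⟨i + 2, by omega⟩ ∧ σ ⟨i + 2, by omega⟩ < σ ⟨i + 1, by omega⟩ := by
  change (∃ h : i + 3 ≤ n, ∀ a b : Fin 3, σ ⟨i + a, by omega⟩ < σ ⟨i + b, by omega⟩ ↔
    (![0, 2, 1] : Fin 3 → Fin 3) a < (![0, 2, 1] : Fin 3 → Fin 3) b) ↔ _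
  refine exists_congr fun h => ⟨fun H => ⟨(H 0 2).2 (by decide), (H 2 1).2 (by decide)⟩, ?_⟩
  rintro ⟨h1, h2⟩ a b
  fin_cases a <;> fin_cases b <;> simp [h1, h2, h1.trans h2, h1.le, h2.le, (h1.trans h2).le]

theorem occursAt_pattern231 {n : ℕ} (σ : Equiv.Perm (Fin n)) (i : ℕ) :
    OccursAt σ i pattern231 ↔ ∃ h : i + 3 ≤ n,
      σ ⟨i + 2, by omega⟩ < σ ⟨i, by omega⟩ ∧ σ ⟨i, by omega⟩ < σ ⟨i + 1, by omega⟩ := by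
  change (∃ h : i + 3 ≤ n, ∀ a b : Fin 3, σ ⟨i + a, by omega⟩ < σ ⟨i + b, by omega⟩ ↔
    (![1, 2, 0] : Fin 3 → Fin 3) a < (![1, 2, 0] : Fin 3 → Fin 3) b) ↔ _
  refine exists_congr fun h => ⟨fun H => ⟨(H 2 0).2 (by decide), (H 0 1).2 (by decide)⟩, ?_⟩
  rintro ⟨h1, h2⟩ a b
  fin_cases a <;> fin_cases b <;> simp [h1, h2, h1.trans h2, h1.le, h2.le, (h1.trans h2).le]

theorem length_of_mem {π : Pattern} (h : π ∈ patterns132and231) : π.1 = 3 := by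
  rcases h with rfl | rfl <;> rfl

theorem peakFrom_of_occursAt {n : ℕ} {σ : Equiv.Perm (Fin n)} {i : ℕ} {π : Pattern}
    (hπ : π ∈ patterns132and231) (h : OccursAt σ i π) : PeakFrom σ i := by
  rcases hπ with rfl | rfl
  · obtain ⟨h, h1, h2⟩ := (occursAt_pattern132 σ i).1 h
    exact ⟨h, h1.trans h2, h2⟩
  · obtain ⟨h, h1, h2⟩ := (occursAt_pattern231 σ i).1 h
    exact ⟨h, h2, h1.trans h2⟩

theorem exists_occursAt_of_peakFrom {n : ℕ} {σ : Equiv.Perm (Fin n)} {i : ℕ}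
    (h : PeakFrom σ i) : ∃ π ∈ patterns132and231, OccursAt σ i π := by
  obtain ⟨hi, h1, h2⟩ := h
  rcases lt_trichotomy (σ ⟨i, by omega⟩) (σ ⟨i + 2, by omega⟩) with h | h | h
  · exact ⟨_, Or.inl rfl, (occursAt_pattern132 σ i).2 ⟨hi, h, h2⟩⟩
  · simpa using σ.injective h
  · exact ⟨_, Or.inr rfl, (occursAt_pattern231 σ i).2 ⟨hi, h, h1⟩⟩

theorem eq_of_occursAt {n : ℕ} {σ : Equiv.Perm (Fin n)} {i : ℕ} {π π' : Pattern}
    (hπ : π ∈ patterns132and231) (hπ' : π' ∈ patterns132and231)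
    (h : OccursAt σ i π) (h' : OccursAt σ i π') : π = π' := by
  rcases hπ with rfl | rfl <;> rcases hπ' with rfl | rfl
  · rfl
  · obtain ⟨_, h1, _⟩ := (occursAt_pattern132 σ i).1 h
    obtain ⟨_, h2, _⟩ := (occursAt_pattern231 σ i).1 h'
    exact absurd h1 h2.asymm
  · obtain ⟨_, h1, _⟩ := (occursAt_pattern231 σ i).1 h
    obtain ⟨_, h2, _⟩ := (occursAt_pattern132 σ i).1 h'
    exact absurd h1 h2.asymm
  · rfl

/-- The first window descends from position `i + 1` to `i + 2`, where the second one would have to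
ascend. -/
theorem not_peakFrom_succ {n : ℕ} {σ : Equiv.Perm (Fin n)} {i : ℕ} (h : PeakFrom σ i) :
    ¬PeakFrom σ (i + 1) := by
  obtain ⟨_, _, h1⟩ := h
  rintro ⟨_, h2, _⟩
  exact absurd h1 h2.asymm

open Classical in
/-- The positions at which the peaks of `σ` start. -/
noncomputable def peakSet {n : ℕ} (σ : Equiv.Perm (Fin n)) : Finset ℕ :=
  {i ∈ Finset.range n | PeakFrom σ i}

theorem mem_peakSet {n : ℕ} {σ : Equiv.Perm (Fin n)} {i : ℕ} : i ∈ peakSet σ ↔ PeakFrom σ i := by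
  classical
  rw [peakSet, Finset.mem_filter, Finset.mem_range]
  refine ⟨fun h => h.2, fun h => ⟨?_, h⟩⟩
  obtain ⟨h, _⟩ := h
  omega

theorem occurrences_eq_card_peakSet {n : ℕ} (σ : Equiv.Perm (Fin n)) :
    occurrences patterns132and231 σ = (peakSet σ).card := by
  rw [occurrences, ← Set.ncard_coe_finset]
  have : (peakSet σ : Set ℕ) =
      Prod.fst '' {o : ℕ × Pattern | o.2 ∈ patterns132and231 ∧ OccursAt σ o.1 o.2} := by
    ext i
    rw [Finset.mem_coe, mem_peakSet]
    constructor
    · intro h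
      obtain ⟨π, h1, h2⟩ := exists_occursAt_of_peakFrom h
      exact ⟨(i, π), ⟨h1, h2⟩, rfl⟩
    · rintro ⟨o, ⟨h1, h2⟩, rfl⟩
      exact peakFrom_of_occursAt h1 h2
  rw [this, Set.InjOn.ncard_image]
  rintro ⟨i, π⟩ ⟨h1, h2⟩ ⟨i', π'⟩ ⟨h1', h2'⟩ (rfl : i = i')
  exact congrArg (Prod.mk i) (eq_of_occursAt h1 h1' h2 h2')

/-- Each block {2q, 2q+1} contains at most one start of a peak; counting blocks then bounds the
number of peaks. -/
theorem injOn_half_peakSet {n : ℕ} (σ : Equiv.Perm (Fin n)) :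
    Set.InjOn (fun i => i / 2) (peakSet σ : Set ℕ) := by
  intro i hi j hj h
  rw [Finset.mem_coe, mem_peakSet] at hi hj
  have h : i / 2 = j / 2 := h
  have h1 : j ≠ i + 1 := by rintro rfl; exact not_peakFrom_succ hi hj
  have h2 : i ≠ j + 1 := by rintro rfl; exact not_peakFrom_succ hj hi
  omega

theorem mapsTo_half_peakSet {n : ℕ} (σ : Equiv.Perm (Fin n)) :
    Set.MapsTo (fun i => i / 2) (peakSet σ : Set ℕ) (Finset.range ((n - 1) / 2) : Set ℕ) := by
  intro i hi
  rw [Finset.mem_coe, mem_peakSet] at hi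
  obtain ⟨h, _⟩ := hi
  simp only [Finset.coe_range, Set.mem_Iio]
  omega

theorem card_peakSet_le {n : ℕ} (σ : Equiv.Perm (Fin n)) : (peakSet σ).card ≤ (n - 1) / 2 := by
  simpa using Finset.card_le_card_of_injOn _ (mapsTo_half_peakSet σ) (injOn_half_peakSet σ)

theorem isUpDown_iff_peakFrom {l : ℕ} (σ : Equiv.Perm (Fin (2 * l + 1))) :
    IsUpDown σ ↔ ∀ k < l, PeakFrom σ (2 * k) := by
  constructor
  · intro h k hk
    exact ⟨by omega, (h (2 * k) (by omega)).1 (by simp),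
      (h (2 * k + 1) (by omega)).2 (by simp)⟩
  · intro h j hj
    constructor
    · intro he
      obtain ⟨k, rfl⟩ := he.two_dvd
      obtain ⟨_, h1, _⟩ := h k (by omega)
      exact h1
    · rintro ⟨k, rfl⟩
      obtain ⟨_, _, h1⟩ := h k (by omega)
      exact h1

/-- If there are `l` peaks, each of the `l` blocks {2k, 2k+1} contains a start. In the last block
the odd start does not fit into the word; and an even start 2k+2 excludes the start 2k+1. Going from
right to left, all starts are even. -/
theorem isUpDown_iff_card_peakSet {l : ℕ} (σ : Equiv.Perm (Fin (2 * l + 1))) :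
    IsUpDown σ ↔ (peakSet σ).card = l := by
  have hmaps := mapsTo_half_peakSet σ
  rw [show (2 * l + 1 - 1) / 2 = l by omega] at hmaps
  rw [isUpDown_iff_peakFrom]
  constructor
  · intro h
    refine le_antisymm ((card_peakSet_le σ).trans (by omega)) ?_
    have := Finset.card_le_card_of_injOn (s := Finset.range l) (t := peakSet σ) (fun k => 2 * k)
      (fun k hk => mem_peakSet.2 (h k (by simpa using hk)))
      (fun a _ b _ hab => by simpa using hab)
    simpa using this
  · intro h
    have hsurj := Finset.surjOn_of_injOn_of_card_le _ hmaps (injOn_half_peakSet σ) (by simp [h])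
    have hor : ∀ k < l, PeakFrom σ (2 * k) ∨ PeakFrom σ (2 * k + 1) := by
      intro k hk
      obtain ⟨i, hi, hik⟩ := hsurj (show k ∈ (Finset.range l : Set ℕ) by simpa using hk)
      have hik : i / 2 = k := hik
      rw [Finset.mem_coe, mem_peakSet] at hi
      rcases (by omega : i = 2 * k ∨ i = 2 * k + 1) with rfl | rfl
      · exact Or.inl hi
      · exact Or.inr hi
    have hrev : ∀ d k, k + d + 1 = l → PeakFrom σ (2 * k) := by
      intro d
      induction d with
      | zero =>
        intro k hk
        refine (hor k (by omega)).resolve_right ?_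
        rintro ⟨h, _⟩
        omega
      | succ d ih =>
        intro k hk
        refine (hor k (by omega)).resolve_right fun h1 => ?_
        exact not_peakFrom_succ h1 (ih (k + 1) (by omega))
    exact fun k hk => hrev (l - 1 - k) k (by omega)

/-! ### Structure and uniqueness of clusters -/

/-- Linked windows of length 3 are shifted by 1 or 2, and a shift by 1 would produce adjacent peaks.
-/
theorem isCluster_position {n l : ℕ} {σ : Equiv.Perm (Fin n)} {π : Fin l → Pattern}
    {i : Fin l → ℕ} (h : IsCluster patterns132and231 σ π i) (k : Fin l) : i k = 2 * k := by
  obtain ⟨k, hk⟩ := k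
  induction k with
  | zero => exact h.first _ rfl
  | succ k ih =>
    have hk' : k < l := by omega
    specialize ih hk'
    have h1 := h.increasing ⟨k, hk'⟩ ⟨k + 1, hk⟩ rfl
    have h2 := h.linked ⟨k, hk'⟩ ⟨k + 1, hk⟩ rfl
    rw [length_of_mem (h.mem _)] at h2
    have h3 : i ⟨k + 1, hk⟩ ≠ i ⟨k, hk'⟩ + 1 := by
      intro he
      refine not_peakFrom_succ (peakFrom_of_occursAt (h.mem ⟨k, hk'⟩) (h.occurs _)) ?_
      rw [← he]
      exact peakFrom_of_occursAt (h.mem _) (h.occurs _)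
    simp only at ih ⊢
    omega

theorem isCluster_length {n l : ℕ} {σ : Equiv.Perm (Fin n)} {π : Fin l → Pattern}
    {i : Fin l → ℕ} (h : IsCluster patterns132and231 σ π i) : n = 2 * l + 1 := by
  cases l with
  | zero => exact h.trivial rfl
  | succ l =>
    have := h.last ⟨l, by omega⟩ rfl
    rw [length_of_mem (h.mem _), isCluster_position h] at this
    simp only at this
    omega

theorem isCluster_unique {n l : ℕ} {σ : Equiv.Perm (Fin n)} {π π' : Fin l → Pattern}
    {i i' : Fin l → ℕ} (h : IsCluster patterns132and231 σ π i)
    (h' : IsCluster patterns132and231 σ π' i') : π = π' ∧ i = i' := by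
  have hi : i = i' := funext fun k => by rw [isCluster_position h, isCluster_position h']
  subst hi
  exact ⟨funext fun k => eq_of_occursAt (h.mem k) (h'.mem k) (h.occurs k) (h'.occurs k), rfl⟩

theorem exists_isCluster_iff {n l : ℕ} (σ : Equiv.Perm (Fin n)) :
    (∃ (π : Fin l → Pattern) (i : Fin l → ℕ), IsCluster patterns132and231 σ π i) ↔
      n = 2 * l + 1 ∧ IsUpDown σ := by
  constructor
  · rintro ⟨π, i, h⟩
    obtain rfl := isCluster_length h
    refine ⟨rfl, (isUpDown_iff_peakFrom σ).2 fun k hk => ?_⟩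
    have := isCluster_position h ⟨k, hk⟩
    simp only at this
    rw [← this]
    exact peakFrom_of_occursAt (h.mem _) (h.occurs _)
  · rintro ⟨rfl, h⟩
    rw [isUpDown_iff_peakFrom] at h
    choose π hπ hocc using fun k : Fin l => exists_occursAt_of_peakFrom (h k k.2)
    refine ⟨π, fun k => 2 * k, hπ, hocc, ?_, ?_, ?_, ?_, ?_⟩
    · intro k k' hk
      omega
    · intro k k' hk
      simp only [length_of_mem (hπ k)]
      omega
    · intro k hk
      omega
    · intro k hk
      simp only [length_of_mem (hπ k)]
      omega
    · rintro rfl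
      rfl

theorem clusterNumber_eq_zero {n l : ℕ} (h : n ≠ 2 * l + 1) :
    clusterNumber patterns132and231 n l = 0 := by
  rw [clusterNumber, Nat.card_eq_zero]
  exact Or.inl ⟨fun c => h (isCluster_length c.2)⟩

/-- Forgetting the marking is injective, and its image, the up–down permutations, consists of those
with `l` peaks. This ties clusters to the top coefficient of the peak polynomial. -/
theorem clusterNumber_eq_occurrenceNumber (l : ℕ) :
    clusterNumber patterns132and231 (2 * l + 1) l =
      occurrenceNumber patterns132and231 (2 * l + 1) l := by
  have key (σ : Equiv.Perm (Fin (2 * l + 1))) : occurrences patterns132and231 σ = l ↔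
      ∃ (π : Fin l → Pattern) (i : Fin l → ℕ), IsCluster patterns132and231 σ π i := by
    rw [exists_isCluster_iff, isUpDown_iff_card_peakSet, occurrences_eq_card_peakSet]
    simp
  refine Nat.card_congr (Equiv.ofBijective
    (fun c => ⟨c.1.1, (key _).2 ⟨c.1.2.1, c.1.2.2, c.2⟩⟩) ⟨?_, ?_⟩)
  · rintro ⟨⟨σ, π, i⟩, h⟩ ⟨⟨σ', π', i'⟩, h'⟩ he
    obtain rfl : σ = σ' := congrArg Subtype.val he
    obtain ⟨rfl, rfl⟩ := isCluster_unique h h'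
    rfl
  · rintro ⟨σ, hσ⟩
    obtain ⟨π, i, h⟩ := (key σ).1 hσ
    exact ⟨⟨(σ, π, i), h⟩, rfl⟩

/-! ### Peak polynomials count occurrences in permutations -/

/-- The condition `i + 2 < l.length` keeps the default value of `getD` from ever being compared. -/
theorem peaks_eq_card (l : List ℕ) : peaks l =
    ((Finset.range l.length).filter fun i => i + 2 < l.length ∧
      l.getD i 0 < l.getD (i + 1) 0 ∧ l.getD (i + 2) 0 < l.getD (i + 1) 0).card := by
  induction l with
  | nil => rfl
  | cons a l ih =>
    match l, ih with
    | [], _ => simp [peaks]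
    | [b], _ =>
      symm
      simp only [peaks, Finset.card_eq_zero, Finset.filter_eq_empty_iff]
      rintro i - ⟨h, _⟩
      simp at h
    | b :: c :: l, ih =>
      rw [peaks, ih, Finset.card_filter, Finset.card_filter, List.length_cons (a := a),
        Finset.sum_range_succ', add_comm]
      congr 1
      · refine Finset.sum_congr rfl fun i _ => ?_
        simp
      · simp

/-- The one-line notation of a permutation. -/
def word {n : ℕ} (σ : Equiv.Perm (Fin n)) : List ℕ := List.ofFn fun i => (σ i : ℕ)

theorem getD_word {n : ℕ} (σ : Equiv.Perm (Fin n)) {i : ℕ} (h : i < n) :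
    (word σ).getD i 0 = σ ⟨i, h⟩ := by
  simp [word, List.getD_eq_getElem?_getD, h]

theorem peaks_word {n : ℕ} (σ : Equiv.Perm (Fin n)) :
    peaks (word σ) = occurrences patterns132and231 σ := by
  rw [peaks_eq_card, occurrences_eq_card_peakSet]
  congr 1
  ext i
  rw [mem_peakSet, Finset.mem_filter, word, List.length_ofFn, ← word, Finset.mem_range]
  constructor
  · rintro ⟨-, h, h1, h2⟩
    rw [getD_word σ (by omega), getD_word σ (by omega)] at h1 h2
    exact ⟨by omega, h1, h2⟩
  · rintro ⟨h, h1, h2⟩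
    refine ⟨by omega, by omega, ?_⟩
    rw [getD_word σ (by omega), getD_word σ (by omega), getD_word σ (by omega)]
    exact ⟨h1, h2⟩

theorem word_mem_orders {n : ℕ} (σ : Equiv.Perm (Fin n)) : word σ ∈ orders (Finset.range n) := by
  rw [mem_orders]
  constructor
  · rw [word, List.nodup_ofFn]
    exact Fin.val_injective.comp σ.injective
  · ext x
    rw [word, List.mem_toFinset, List.mem_ofFn, Finset.mem_range]
    constructor
    · rintro ⟨i, rfl⟩
      exact (σ i).2
    · intro hx
      exact ⟨σ.symm ⟨x, hx⟩, by simp⟩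

theorem word_injective {n : ℕ} : Function.Injective (word (n := n)) := by
  intro σ τ h
  ext i
  exact congrFun (List.ofFn_injective h) i

theorem exists_word_eq {n : ℕ} {l : List ℕ} (hl : l ∈ orders (Finset.range n)) :
    ∃ σ : Equiv.Perm (Fin n), word σ = l := by
  have hlen : l.length = n := by rw [length_of_mem_orders hl, Finset.card_range]
  subst hlen
  have hlt (i : Fin l.length) : l[i] < l.length :=
    Finset.mem_range.1 ((mem_of_mem_orders hl).1 (List.getElem_mem i.2))
  have hinj : Function.Injective fun i : Fin l.length => (⟨l[i], hlt i⟩ : Fin l.length) := by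
    intro i j h
    have h : l[(i : ℕ)] = l[(j : ℕ)] := congrArg Fin.val h
    exact Fin.ext (((mem_orders.1 hl).1.getElem_inj_iff).1 h)
  refine ⟨Equiv.ofBijective _ (Finite.injective_iff_bijective.1 hinj), ?_⟩
  exact List.ofFn_getElem

theorem peakPoly_eq_sum (n : ℕ) : peakPoly n =
    ∑ σ : Equiv.Perm (Fin n), (Polynomial.X : Polynomial ℚ) ^ occurrences patterns132and231 σ := by
  symm
  refine Finset.sum_bij (fun σ _ => word σ) (fun σ _ => word_mem_orders σ)
    (fun σ _ τ _ h => word_injective h) (fun l hl => ?_) (fun σ _ => by rw [peaks_word])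
  obtain ⟨σ, rfl⟩ := exists_word_eq hl
  exact ⟨σ, Finset.mem_univ _, rfl⟩

theorem coeff_peakPoly (n k : ℕ) :
    (peakPoly n).coeff k = occurrenceNumber patterns132and231 n k := by
  classical
  rw [peakPoly_eq_sum, Polynomial.finsetSum_coeff, occurrenceNumber, Nat.card_eq_fintype_card,
    Fintype.card_subtype]
  simp [Polynomial.coeff_X_pow, eq_comm]

theorem natDegree_peakPoly_le (n : ℕ) : (peakPoly n).natDegree ≤ (n - 1) / 2 := by
  rw [peakPoly_eq_sum]
  refine Polynomial.natDegree_sum_le_of_forall_le _ _ fun σ _ => ?_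
  rw [Polynomial.natDegree_X_pow, occurrences_eq_card_peakSet]
  exact card_peakSet_le σ

/-! ### The Riccati equation of the occurrence series -/

/-- The peak polynomial of length `n`, divided by `n!`. -/
noncomputable def peakPolyExp (n : ℕ) : Polynomial ℚ :=
  Polynomial.C ((n.factorial : ℚ)⁻¹) * peakPoly n

theorem peakPolyExp_zero : peakPolyExp 0 = 1 := by
  simp [peakPolyExp, peakPoly_zero]

theorem natDegree_peakPolyExp_le (n : ℕ) : (peakPolyExp n).natDegree ≤ (n - 1) / 2 :=
  (Polynomial.natDegree_C_mul_le _ _).trans (natDegree_peakPoly_le n)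

theorem coeff_peakPolyExp (n k : ℕ) : (peakPolyExp n).coeff k =
    occurrenceNumber patterns132and231 n k / n.factorial := by
  rw [peakPolyExp, Polynomial.coeff_C_mul, coeff_peakPoly, div_eq_inv_mul]

theorem peakPolyExp_succ (n : ℕ) : peakPolyExp (n + 1) * ((n : Polynomial ℚ) + 1) =
    ∑ p ∈ Finset.HasAntidiagonal.antidiagonal n,
      peakWeight p.1 p.2 * (peakPolyExp p.1 * peakPolyExp p.2) := by
  have h := peakPoly_succ_div_factorial n
  change _ = ∑ p ∈ Finset.HasAntidiagonal.antidiagonal n,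
    peakWeight p.1 p.2 * (peakPolyExp p.1 * peakPolyExp p.2) at h
  rw [← h, peakPolyExp, mul_right_comm]
  congr 1
  have h1 : (n : ℚ) + 1 ≠ 0 := by positivity
  rw [show (n : Polynomial ℚ) + 1 = Polynomial.C ((n : ℚ) + 1) by simp, ← Polynomial.C_mul,
    Nat.factorial_succ]
  congr 1
  push_cast
  field_simp

open PowerSeries in
theorem coeff_occurrenceSeries (n : ℕ) :
    coeff n (occurrenceSeries patterns132and231) = (peakPolyExp n : PowerSeries ℚ) := by
  ext k
  rw [occurrenceSeries, coeff_mk, coeff_mk, Polynomial.coeff_coe, coeff_peakPolyExp]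

-- F - 1 accounts for a nonempty side of the maximum and 1 for an empty one. The four terms are the
-- four combinations, and the factor t marks the peak that arises when both sides are nonempty.
open PowerSeries in
theorem derivative_occurrenceSeries :
    derivative (PowerSeries ℚ) (occurrenceSeries patterns132and231) =
      C (X : PowerSeries ℚ) * ((occurrenceSeries patterns132and231 - 1) *
        (occurrenceSeries patterns132and231 - 1)) +
      (occurrenceSeries patterns132and231 - 1) + (occurrenceSeries patterns132and231 - 1) + 1 := by
  set F := occurrenceSeries patterns132and231 with hF
  -- Written as products, all four terms have coefficients that are sums over the same antidiagonal,
  -- so they can be compared summand by summand.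
  have hr : C (X : PowerSeries ℚ) * ((F - 1) * (F - 1)) + (F - 1) + (F - 1) + 1 =
      C (X : PowerSeries ℚ) * ((F - 1) * (F - 1)) + (F - 1) * 1 + 1 * (F - 1) + 1 * 1 := by
    ring
  ext1 n
  have hl : coeff (n + 1) F * ((n : PowerSeries ℚ) + 1) =
      ((peakPolyExp (n + 1) * ((n : Polynomial ℚ) + 1) : Polynomial ℚ) : PowerSeries ℚ) := by
    rw [hF, coeff_occurrenceSeries, ← Polynomial.coeToPowerSeries.ringHom_apply,
      ← Polynomial.coeToPowerSeries.ringHom_apply, map_mul, map_add, map_natCast, map_one]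
  rw [coeff_derivative, hl, peakPolyExp_succ, hr, map_add, map_add, map_add, coeff_C_mul, coeff_mul,
    coeff_mul, coeff_mul, coeff_mul, Finset.mul_sum, ← Finset.sum_add_distrib,
    ← Finset.sum_add_distrib, ← Finset.sum_add_distrib, ← Polynomial.coeToPowerSeries.ringHom_apply,
    map_sum]
  refine Finset.sum_congr rfl fun p _ => ?_
  rw [Polynomial.coeToPowerSeries.ringHom_apply, Polynomial.coe_mul, Polynomial.coe_mul, map_sub,
    map_sub, hF, coeff_occurrenceSeries, coeff_occurrenceSeries, peakWeight]
  simp only [coeff_one]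
  rcases eq_or_ne p.1 0 with h1 | h1 <;> rcases eq_or_ne p.2 0 with h2 | h2 <;>
    simp [h1, h2, peakPolyExp_zero]

open PowerSeries in
theorem constantCoeff_occurrenceSeries :
    constantCoeff (occurrenceSeries patterns132and231) = 1 := by
  rw [← coeff_zero_eq_constantCoeff_apply, coeff_occurrenceSeries, peakPolyExp_zero]
  simp

/-! ### Top coefficients and tangent numbers -/

/-- The coefficients of the exponential generating function of the permutations with the largest
possible number of peaks. -/
noncomputable def topCoeff (n : ℕ) : ℚ := if Odd n then (peakPolyExp n).coeff (n / 2) else 0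

/-- By the degree bound (k-1)/2, the power t^m is out of reach when a side is empty or when both
sides have positive even length, even with the extra factor t. For two odd lengths it comes exactly
from the product of the top terms. -/
theorem coeff_peakWeight_mul {i j m : ℕ} (h : i + j = 2 * m) (hm : m ≠ 0) :
    (peakWeight i j * (peakPolyExp i * peakPolyExp j)).coeff m = topCoeff i * topCoeff j := by
  have hlt : ∀ k, (k - 1) / 2 < m → (peakPolyExp k).coeff m = 0 := fun k hk =>
    Polynomial.coeff_eq_zero_of_natDegree_lt ((natDegree_peakPolyExp_le k).trans_lt hk)
  rcases eq_or_ne i 0 with rfl | hi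
  · simp [peakWeight, topCoeff, peakPolyExp_zero, hlt j (by omega)]
  rcases eq_or_ne j 0 with rfl | hj
  · simp [peakWeight, topCoeff, peakPolyExp_zero, hlt i (by omega)]
  obtain ⟨m, rfl⟩ := Nat.exists_eq_succ_of_ne_zero hm
  rw [peakWeight, if_neg (by omega), Nat.succ_eq_add_one, Polynomial.coeff_X_mul]
  have hdi := natDegree_peakPolyExp_le i
  have hdj := natDegree_peakPolyExp_le j
  rcases Nat.even_or_odd i with he | ho
  · rw [topCoeff, if_neg (Nat.not_odd_iff_even.2 he), zero_mul]
    obtain ⟨a, rfl⟩ := he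
    refine Polynomial.coeff_eq_zero_of_natDegree_lt (Polynomial.natDegree_mul_le.trans_lt ?_)
    omega
  · have hoj : Odd j := by
      by_contra hc
      have h2 : Odd (i + j) := ho.add_even (Nat.not_odd_iff_even.1 hc)
      rw [h] at h2
      exact Nat.not_odd_iff_even.2 (even_two_mul _) h2
    rw [topCoeff, if_pos ho, topCoeff, if_pos hoj]
    obtain ⟨a, rfl⟩ := ho
    obtain ⟨b, rfl⟩ := hoj
    rw [show m = (2 * a + 1) / 2 + (2 * b + 1) / 2 by omega]
    exact Polynomial.coeff_mul_add_eq_of_natDegree_le (by omega) (by omega)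

/-- For even `n` this is the coefficient of t^(n/2) in `peakPolyExp_succ`; the extra 1 at `n = 0` is
the case of two empty sides. For odd `n` both sides vanish, as one index of each pair is even. -/
theorem topCoeff_succ (n : ℕ) : topCoeff (n + 1) * (n + 1) = (if n = 0 then 1 else 0) +
    ∑ p ∈ Finset.HasAntidiagonal.antidiagonal n, topCoeff p.1 * topCoeff p.2 := by
  rcases Nat.even_or_odd n with he | ho
  · have h := congrArg (fun f => Polynomial.coeff f (n / 2)) (peakPolyExp_succ n)
    have h2 : (n + 1) / 2 = n / 2 := by obtain ⟨m, rfl⟩ := he; omega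
    simp only [Polynomial.finsetSum_coeff] at h
    rw [show (n : Polynomial ℚ) + 1 = Polynomial.C ((n : ℚ) + 1) by simp,
      Polynomial.coeff_mul_C] at h
    rw [topCoeff, if_pos he.add_one, h2, h]
    rcases eq_or_ne n 0 with rfl | hn
    · simp [peakWeight, peakPolyExp_zero, topCoeff]
    · rw [if_neg hn, zero_add]
      refine Finset.sum_congr rfl fun p hp => ?_
      rw [Finset.HasAntidiagonal.mem_antidiagonal] at hp
      obtain ⟨m, rfl⟩ := he
      exact coeff_peakWeight_mul (by omega) (by omega)
  · rw [topCoeff, if_neg (Nat.not_odd_iff_even.2 ho.add_one), if_neg (by rintro rfl; simp at ho),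
      zero_mul, zero_add]
    symm
    refine Finset.sum_eq_zero fun p hp => ?_
    rw [Finset.HasAntidiagonal.mem_antidiagonal] at hp
    rcases Nat.even_or_odd p.1 with h1 | h1
    · rw [topCoeff, if_neg (Nat.not_odd_iff_even.2 h1), zero_mul]
    · have h2 : Even p.2 := by
        by_contra hc
        exact Nat.not_odd_iff_even.2 (h1.add_odd (Nat.not_even_iff_odd.1 hc)) (hp ▸ ho)
      rw [topCoeff, topCoeff, if_neg (Nat.not_odd_iff_even.2 h2), mul_zero]

open PowerSeries in
theorem mk_topCoeff : PowerSeries.mk topCoeff = tanSeries := by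
  apply eq_tanSeries
  · rw [← coeff_zero_eq_constantCoeff_apply, coeff_mk]
    simp [topCoeff]
  · ext n
    rw [coeff_derivative, coeff_mk, topCoeff_succ, sq, map_add, coeff_one, coeff_mul]
    simp only [coeff_mk]

theorem clusterNumber_eq_tangentNumber (l : ℕ) :
    (clusterNumber patterns132and231 (2 * l + 1) l : ℚ) = tangentNumber l := by
  have h := Nat.factorial_ne_zero (2 * l + 1)
  rw [tangentNumber, ← mk_topCoeff, PowerSeries.coeff_mk, topCoeff, if_pos (odd_two_mul_add_one l),
    coeff_peakPolyExp, show (2 * l + 1) / 2 = l by omega, clusterNumber_eq_occurrenceNumber]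
  field_simp

theorem topCoeff_nonneg (n : ℕ) : 0 ≤ topCoeff n := by
  rw [topCoeff]
  split_ifs
  · rw [coeff_peakPolyExp]
    positivity
  · exact le_rfl

/-- All terms of the convolution are nonnegative, and the one at (1, 2l+1) is positive by induction.
-/
theorem topCoeff_pos (l : ℕ) : 0 < topCoeff (2 * l + 1) := by
  suffices 0 < topCoeff (2 * l + 1) * ((2 * l : ℕ) + 1 : ℚ) from
    pos_of_mul_pos_left this (by positivity)
  rw [topCoeff_succ]
  induction l with
  | zero => simp [topCoeff]
  | succ l ih =>
    rw [← topCoeff_succ] at ih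
    have h1 : 0 < topCoeff 1 := by
      have := topCoeff_succ 0
      simp [topCoeff] at this ⊢
      simp [this]
    refine add_pos_of_nonneg_of_pos (by split_ifs <;> simp) ?_
    refine Finset.sum_pos' (fun p _ => mul_nonneg (topCoeff_nonneg _) (topCoeff_nonneg _))
      ⟨(1, 2 * l + 1), ?_, mul_pos h1 (pos_of_mul_pos_left ih (by positivity))⟩
    rw [Finset.HasAntidiagonal.mem_antidiagonal]
    ring

theorem clusterNumber_ne_zero_iff (n l : ℕ) :
    clusterNumber patterns132and231 n l ≠ 0 ↔ n = 2 * l + 1 := by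
  constructor
  · exact fun h => by_contra fun hn => h (clusterNumber_eq_zero hn)
  · rintro rfl h
    have h1 := clusterNumber_eq_tangentNumber l
    have h2 := Nat.cast_pos (α := ℚ).2 (Nat.factorial_pos (2 * l + 1))
    rw [h, tangentNumber, ← mk_topCoeff, PowerSeries.coeff_mk, Nat.cast_zero] at h1
    exact (mul_pos h2 (topCoeff_pos l)).ne h1

/-! ### Closed form of the occurrence series -/

open PowerSeries in
theorem occurrenceSeries_mul_eq_one {s : PowerSeries ℚ} (hs : s ^ 2 = 1 - PowerSeries.X) :
    occurrenceSeries patterns132and231 * (1 - PowerSeries.C s⁻¹ * tanhMul s) = 1 := by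
  have : CharZero (PowerSeries ℚ) :=
    charZero_of_injective_ringHom (PowerSeries.C_injective (R := ℚ))
  exact mul_one_sub_eq_one_of_derivative hs (mul_inv_cancel_of_sq_eq_one_sub_X hs)
    (derivative_tanhMul s) (constantCoeff_tanhMul s) derivative_occurrenceSeries
    constantCoeff_occurrenceSeries

end ConsecutivePattern

/-- Clusters, cluster numbers and the occurrence generating function for `{132, 231}`.
In the last two clauses `s` is a square root of `1 - t` in `ℚ⟦t⟧`, and the equation says that the
generating function is the inverse of `1 - tanh (x s) / s` in `ℚ⟦t⟧⟦x⟧`. -/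
theorem mainTheorem8 :
    (∀ (n l : ℕ) (σ : Equiv.Perm (Fin n)),
      (∃ (π : Fin l → ConsecutivePattern.Pattern) (i : Fin l → ℕ),
        ConsecutivePattern.IsCluster ConsecutivePattern.patterns132and231 σ π i) ↔
      (n = 2 * l + 1 ∧ ConsecutivePattern.IsUpDown σ)) ∧
    (∀ (n l : ℕ) (σ : Equiv.Perm (Fin n)) (π π' : Fin l → ConsecutivePattern.Pattern)
      (i i' : Fin l → ℕ),
      ConsecutivePattern.IsCluster ConsecutivePattern.patterns132and231 σ π i →
      ConsecutivePattern.IsCluster ConsecutivePattern.patterns132and231 σ π' i' →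
      π = π' ∧ i = i') ∧
    (∀ n l : ℕ,
      ConsecutivePattern.clusterNumber ConsecutivePattern.patterns132and231 n l ≠ 0 ↔
        n = 2 * l + 1) ∧
    (∀ l : ℕ,
      (ConsecutivePattern.clusterNumber ConsecutivePattern.patterns132and231 (2 * l + 1) l : ℚ) =
        ConsecutivePattern.tangentNumber l) ∧
    (∃ s : PowerSeries ℚ, s ^ 2 = 1 - PowerSeries.X) ∧
    (∀ s : PowerSeries ℚ, s ^ 2 = 1 - PowerSeries.X →
      ConsecutivePattern.occurrenceSeries ConsecutivePattern.patterns132and231 *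
        (1 - PowerSeries.C s⁻¹ * ConsecutivePattern.tanhMul s) = 1) := by
  exact ⟨fun _ _ σ => ConsecutivePattern.exists_isCluster_iff σ,
    fun _ _ _ _ _ _ _ h h' => ConsecutivePattern.isCluster_unique h h',
    ConsecutivePattern.clusterNumber_ne_zero_iff,
    ConsecutivePattern.clusterNumber_eq_tangentNumber,
    ConsecutivePattern.exists_sq_eq_one_sub_X,
    fun _ hs => ConsecutivePattern.occurrenceSeries_mul_eq_one hs⟩
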